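/- **Theorem 3.4.** A *pentagonal chain* $PG_n$ ($n\ge 1$) consists of $n$ pentagons $O_1,\dots,O_n$, the vertices of $O_k$ being labelled $x_1,\dots,x_5$ along the cycle; for $1\le m<n$ one edge joins a vertex $u_m$ of $O_m$ to the vertex $x_1$ of $O_{m+1}$. The vertex $u_1$ is arbitrary. For $m\ge 2$ the step from $PG_m$ to $PG_{m+1}$ is of the *first kind* if $u_m\in\{x_2,x_5\}$ (in $O_m$) and of the *second kind* if $u_m\in\{x_3,x_4\}$; put $Z^i_m=1$ if the step is of the $i$-th kind and $Z^i_m=0$ otherwise ($i=1,2$). Assume that the pairs $(Z^1_m,Z^2_m)$, $m\ge 2$, are independent random vectors with $\mathbb P(Z^i_m=1)=p_i$ and $\mathbb P(Z^i_m=0)=1-p_i$, where $0<p_i<1$ and $p_2=1-p_1$ do not depend on $m$. For a finite connected graph $G$ let $Kf^+(G)=\sum_{\{u,v\}\subseteq V_G}\big(d(u)+d(v)\big)\,r(u,v)$ be the additive degree-Kirchhoff index, where $d(u)$ is the degree of $u$ and $r(u,v)$ is the resistance distance, that is, the potential difference between $u$ and $v$ when every edge is a unit resistor and a unit current enters at $u$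 and leaves at $v$. For $m\ge2$ let $\tilde U_m=216Z^1_m+264Z^2_m$ and $\tilde V_m=133Z^1_m+181Z^2_m$, and let \begin{align*} \sigma_4^2&=216^2p_1+264^2(1-p_1)-\big(216p_1+264(1-p_1)\big)^2,\\ \tilde\sigma_4^2&=133^2p_1+181^2(1-p_1)-\big(133p_1+181(1-p_1)\big)^2,\\ r_4&=216\cdot133\,p_1+264\cdot181\,(1-p_1)-\big(216p_1+264(1-p_1)\big)\big(133p_1+181(1-p_1)\big). \end{align*} Then $\mathrm{Var}(\tilde U_m)=\sigma_4^2$, $\mathrm{Var}(\tilde V_m)=\tilde\sigma_4^2$ and $\mathrm{Cov}(\tilde U_m,\tilde V_m)=r_4$ for all $m\ge2$, and: (i) For every $n\ge1$ the random variable $Kf^+(PG_n)$ is square integrable and \begin{align*} \mathrm{Var}\big(Kf^+(PG_n)\big)=\tfrac1{30}\Big(&\sigma_4^2n^5-5r_4n^4+10\tilde\sigma_4^2n^3+(65r_4-30\sigma_4^2-45\tilde\sigma_4^2)n^2\\ &+(59\sigma_4^2+65\tilde\sigma_4^2-120r_4)n+(60r_4-30\sigma_4^2-30\tilde\sigma_4^2)\Big).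 \end{align*} (ii) As $n\to\infty$, $Kf^+(PG_n)$ is asymptotically normal, uniformly in $a$: $$\lim_{n\to\infty}\ \sup_{a\in\mathbb R}\left|\mathbb P\left(\frac{Kf^+(PG_n)-\mathbb E\big(Kf^+(PG_n)\big)}{\sqrt{\mathrm{Var}\big(Kf^+(PG_n)\big)}}\le a\right)-\int_{-\infty}^a\frac1{\sqrt{2\pi}}e^{-t^2/2}\,dt\right|=0 .$$ -/

import Mathlib

open MeasureTheory ProbabilityTheory Filter Topology

namespace PentagonChain

section Resistance

variable {V : Type*} [Fintype V] [DecidableEq V]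

/-- `φ` is an electric potential on `G` (every edge being a unit resistor) for which a unit current
enters at `u` and leaves at `v`. By Ohm's law and Kirchhoff's current law the net current leaving a
vertex `w` is `∑_{x ∼ w} (φ w - φ x)`, the entry at `w` of the Laplacian applied to `φ`. -/
def IsUnitPotential (G : SimpleGraph V) [DecidableRel G.Adj] (u v : V) (φ : V → ℝ) : Prop :=
  (G.lapMatrix ℝ).mulVec φ = Pi.single u 1 - Pi.single v 1

/-- The resistance distance `r(u,v)`: the potential difference between `u` and `v` when a unit
current enters at `u` and leaves at `v`. It does not depend on the potential, see
`resistanceDist_eq`. (A potential exists as soon as `u` and `v` lie in one connected component;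
otherwise the value is the junk value `0`, which never occurs for the connected graphs below.) -/
noncomputable def resistanceDist (G : SimpleGraph V) [DecidableRel G.Adj] (u v : V) : ℝ :=
  open Classical in
  if h : ∃ φ : V → ℝ, IsUnitPotential G u v φ then h.choose u - h.choose v else 0

theorem IsUnitPotential.sub_eq {G : SimpleGraph V} [DecidableRel G.Adj] {u v : V} {φ ψ : V → ℝ}
    (hφ : IsUnitPotential G u v φ) (hψ : IsUnitPotential G u v ψ) : φ u - φ v = ψ u - ψ v := by
  have key : ∀ f g : V → ℝ, IsUnitPotential G u v g →
      dotProduct f ((G.lapMatrix ℝ).mulVec g) = f u - f v := by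
    intro f g hg
    unfold IsUnitPotential at hg
    rw [hg, dotProduct_sub, dotProduct_single, dotProduct_single, mul_one, mul_one]
  rw [← key φ ψ hψ, ← key ψ φ hφ, Matrix.dotProduct_mulVec, ← Matrix.mulVec_transpose,
    (G.isSymm_lapMatrix (R := ℝ)).eq, dotProduct_comm]

theorem resistanceDist_eq {G : SimpleGraph V} [DecidableRel G.Adj] {u v : V} {φ : V → ℝ}
    (hφ : IsUnitPotential G u v φ) : resistanceDist G u v = φ u - φ v := by
  have h : ∃ φ : V → ℝ, IsUnitPotential G u v φ := ⟨φ, hφ⟩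
  rw [resistanceDist, dif_pos h]
  exact h.choose_spec.sub_eq hφ

/-- The additive degree-Kirchhoff index `Kf⁺(G) = ∑_{{u,v} ⊆ V} (d(u) + d(v)) r(u,v)`. The sum over
unordered pairs is written as half of the sum over ordered pairs (the summand is symmetric, and
`r(u,u) = 0`). -/
noncomputable def additiveDegreeKirchhoff (G : SimpleGraph V) [DecidableRel G.Adj] : ℝ :=
  (1 / 2) * ∑ u : V, ∑ v : V, ((G.degree u : ℝ) + (G.degree v : ℝ)) * resistanceDist G u v

end Resistance

/-- The pentagonal chain `PG_n` with pentagons `O_1, …, O_n`. The pair `(k, i)` stands for the vertex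
`x_{i+1}` of the pentagon `O_{k+1}`, the vertices `x_1, …, x_5` being labelled along the cycle. For
`1 ≤ m < n` an edge joins the vertex `u_m` of `O_m`, the one with label `x_{t m + 1}`, to the vertex
`x_1` of `O_{m+1}`. -/
def chainGraph (n : ℕ) (t : ℕ → Fin 5) : SimpleGraph (Fin n × Fin 5) where
  Adj a b :=
    (a.1 = b.1 ∧ (SimpleGraph.cycleGraph 5).Adj a.2 b.2) ∨
    (b.1.val = a.1.val + 1 ∧ a.2 = t (a.1.val + 1) ∧ b.2 = 0) ∨
    (a.1.val = b.1.val + 1 ∧ b.2 = t (b.1.val + 1) ∧ a.2 = 0)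
  symm := ⟨by
    rintro a b (h | h | h)
    · exact Or.inl ⟨h.1.symm, h.2.symm⟩
    · exact Or.inr (Or.inr h)
    · exact Or.inr (Or.inl h)⟩
  loopless := ⟨by
    rintro a (h | h | h)
    · exact (SimpleGraph.cycleGraph 5).loopless.irrefl _ h.2
    · omega
    · omega⟩

instance (n : ℕ) (t : ℕ → Fin 5) : DecidableRel (chainGraph n t).Adj := fun a b =>
  inferInstanceAs (Decidable
    ((a.1 = b.1 ∧ (SimpleGraph.cycleGraph 5).Adj a.2 b.2) ∨
    (b.1.val = a.1.val + 1 ∧ a.2 = t (a.1.val + 1) ∧ b.2 = 0) ∨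
    (a.1.val = b.1.val + 1 ∧ b.2 = t (b.1.val + 1) ∧ a.2 = 0)))

/-- The random choices that build the random pentagonal chain. For `m ≥ 2` the step from `PG_m` to
`PG_{m+1}` is of the first kind (`Z₁ m = 1`, `Z₂ m = 0`) when the attaching vertex `u_m` is `x_2` or
`x_5` of `O_m`, and of the second kind (`Z₁ m = 0`, `Z₂ m = 1`) when it is `x_3` or `x_4`. The pairs
`(Z₁ m, Z₂ m)`, `m ≥ 2`, are independent, and the two kinds have the probabilities `p₁`, `p₂` at each
step. The attaching vertex `u_1` of the first pentagon is arbitrary. -/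
structure IsRandomChain {Ω : Type*} [MeasurableSpace Ω] (P : Measure Ω) (p₁ p₂ : ℝ)
    (Z₁ Z₂ : ℕ → Ω → ℝ) (t : ℕ → Ω → Fin 5) : Prop where
  choice : ∀ m, 2 ≤ m → ∀ ω,
    (Z₁ m ω = 1 ∧ Z₂ m ω = 0 ∧ (t m ω = 1 ∨ t m ω = 4)) ∨
    (Z₁ m ω = 0 ∧ Z₂ m ω = 1 ∧ (t m ω = 2 ∨ t m ω = 3))
  measurable_fst : ∀ m, 2 ≤ m → Measurable (Z₁ m)
  measurable_snd : ∀ m, 2 ≤ m → Measurable (Z₂ m)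
  law_fst : ∀ m, 2 ≤ m → P.real {ω | Z₁ m ω = 1} = p₁ ∧ P.real {ω | Z₁ m ω = 0} = 1 - p₁
  law_snd : ∀ m, 2 ≤ m → P.real {ω | Z₂ m ω = 1} = p₂ ∧ P.real {ω | Z₂ m ω = 0} = 1 - p₂
  indep : iIndepFun (fun (m : {m : ℕ // 2 ≤ m}) (ω : Ω) => (Z₁ m.1 ω, Z₂ m.1 ω)) P

/-- The random variable `Kf⁺(PG_n)`. -/
noncomputable def kfPlus {Ω : Type*} (t : ℕ → Ω → Fin 5) (n : ℕ) (ω : Ω) : ℝ :=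
  additiveDegreeKirchhoff (chainGraph n (fun m => t m ω))

/-- `σ₄²` -/
def sigmaSq (p₁ : ℝ) : ℝ :=
  216 ^ 2 * p₁ + 264 ^ 2 * (1 - p₁) - (216 * p₁ + 264 * (1 - p₁)) ^ 2

/-- `σ̃₄²` -/
def sigmaTildeSq (p₁ : ℝ) : ℝ :=
  133 ^ 2 * p₁ + 181 ^ 2 * (1 - p₁) - (133 * p₁ + 181 * (1 - p₁)) ^ 2

/-- `r₄` -/
def rCov (p₁ : ℝ) : ℝ :=
  216 * 133 * p₁ + 264 * 181 * (1 - p₁)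
    - (216 * p₁ + 264 * (1 - p₁)) * (133 * p₁ + 181 * (1 - p₁))

end PentagonChain

/-! Resistances in the chain are explicit. Inside a pentagon two labels at difference a are joined
by parallel paths of lengths a and 5 - a, giving a(5 - a)/5; bridges act in series. The guess
`chainRes` is verified through its Laplacian: `lapMatrix_mulVec_chainRes` shows that, apart from the
point mass at the base vertex, this Laplacian does not depend on the base vertex, so half the
difference of two such functions is a unit potential.

Summation then gives the index of PG_{N+1} as a constant plus 48 ∑ (i+1)(N-1-i) Z₂(i+2)
(`exists_additiveDegreeKirchhoff_chainGraph`), where u_1 has weight 0. Only independent Bernoulli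
variables with deterministic weights remain. The sum of the squared weights is (N⁵ - N)/30, which
gives the variance.

For normality, the weights are O(N²) while the normalization has order N^{5/2}, so the normalized
weights are uniformly small. Comparing products of characteristic functions factor by factor gives
convergence to the Gaussian one (`tendsto_charFun_weighted_sum`); Lévy continuity and Pólya's
theorem make the convergence of distribution functions uniform. -/

namespace PentagonChain

/-! ### Resistances in the pentagon and in the chain. -/

/-- The resistance distance in the pentagon between two vertices whose labels differ by `a`. -/
noncomputable def pentagonRes (a : Fin 5) : ℝ := (a.val : ℝ) * (5 - a.val) / 5

/-- The resistance distance from the vertex `x_1` of the first pentagon along the chain to the vertex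
`x_1` of the pentagon with index `k`, up to a contribution of the first pentagon. -/
noncomputable def spine (t : ℕ → Fin 5) (k : ℕ) : ℝ :=
  ∑ m ∈ Finset.range k, (1 + pentagonRes (t (m + 1)))

/-- The explicit resistance distance of the pentagonal chain. -/
noncomputable def chainRes (t : ℕ → Fin 5) (k : ℕ) (i : Fin 5) (l : ℕ) (j : Fin 5) : ℝ :=
  if k = l then pentagonRes (i - j)
  -- `spine t (k + 1)` already contains the bridge leaving pentagon `k`; the `+ 1` restores that
  -- bridge.
  else if k < l then spine t l - spine t (k + 1) + 1 + pentagonRes (i - t (k + 1)) + pentagonRes j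
  else spine t k - spine t (l + 1) + 1 + pentagonRes (j - t (l + 1)) + pentagonRes i

theorem pentagonRes_zero : pentagonRes 0 = 0 := by simp [pentagonRes]

theorem pentagonRes_one : pentagonRes 1 = 4 / 5 := by norm_num [pentagonRes]

theorem pentagonRes_two : pentagonRes 2 = 6 / 5 := by norm_num [pentagonRes]

theorem pentagonRes_three : pentagonRes 3 = 6 / 5 := by norm_num [pentagonRes]

theorem pentagonRes_four : pentagonRes 4 = 4 / 5 := by norm_num [pentagonRes]

theorem pentagonRes_sub_comm (i j : Fin 5) : pentagonRes (i - j) = pentagonRes (j - i) := by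
  have key : ∀ a : Fin 5, pentagonRes (-a) = pentagonRes a := by
    intro a
    fin_cases a <;> norm_num [pentagonRes, Fin.neg_def]
  rw [← key (j - i), neg_sub]

theorem sum_pentagonRes : ∑ i, pentagonRes i = 4 := by
  simp only [Fin.sum_univ_five, pentagonRes_zero, pentagonRes_one, pentagonRes_two,
    pentagonRes_three, pentagonRes_four]
  norm_num

theorem sum_pentagonRes_sub (a : Fin 5) : ∑ i, pentagonRes (i - a) = 4 := by
  rw [← sum_pentagonRes]
  exact Equiv.sum_comp (Equiv.subRight a) pentagonRes

theorem sum_pentagonRes_sub' (a : Fin 5) : ∑ i, pentagonRes (a - i) = 4 := by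
  rw [← sum_pentagonRes]
  exact Equiv.sum_comp (Equiv.subLeft a) pentagonRes

theorem sum_cycle_adj (f : Fin 5 → ℝ) (j : Fin 5) :
    (∑ i, if (SimpleGraph.cycleGraph 5).Adj j i then f i else 0) = f (j + 1) + f (j - 1) := by
  have hset : (Finset.univ.filter fun i => (SimpleGraph.cycleGraph 5).Adj j i) = {j + 1, j - 1} := by
    revert j; decide
  have hne : j + 1 ≠ j - 1 := by revert j; decide
  rw [← Finset.sum_filter, hset, Finset.sum_pair hne]

/-- a(5 - a)/5 is quadratic, so its second difference is constant; the kink at 0 carries the -2 that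
makes the total over the cycle vanish. -/
theorem pentagonRes_laplacian (a : Fin 5) :
    2 * pentagonRes a - pentagonRes (a + 1) - pentagonRes (a - 1)
      = 2 / 5 - 2 * (if a = 0 then 1 else 0) := by
  fin_cases a
  · change 2 * pentagonRes 0 - pentagonRes 1 - pentagonRes 4 = _
    norm_num [pentagonRes_zero, pentagonRes_one, pentagonRes_four]
  · change 2 * pentagonRes 1 - pentagonRes 2 - pentagonRes 0 = _
    norm_num [pentagonRes_zero, pentagonRes_one, pentagonRes_two]
  · change 2 * pentagonRes 2 - pentagonRes 3 - pentagonRes 1 = _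
    norm_num [pentagonRes_three, pentagonRes_one, pentagonRes_two, Fin.ext_iff]
  · change 2 * pentagonRes 3 - pentagonRes 4 - pentagonRes 2 = _
    norm_num [pentagonRes_three, pentagonRes_four, pentagonRes_two, Fin.ext_iff]
  · change 2 * pentagonRes 4 - pentagonRes 0 - pentagonRes 3 = _
    norm_num [pentagonRes_three, pentagonRes_four, pentagonRes_zero, Fin.ext_iff]

theorem spine_succ (t : ℕ → Fin 5) (k : ℕ) :
    spine t (k + 1) = spine t k + (1 + pentagonRes (t (k + 1))) :=
  Finset.sum_range_succ _ _

/-- The sum of a function over the neighbours of a vertex of the pentagonal chain. -/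
theorem sum_neighborFinset_chainGraph (n : ℕ) (t : ℕ → Fin 5) (w : Fin n × Fin 5)
    (g : ℕ → Fin 5 → ℝ) :
    ∑ x ∈ (chainGraph n t).neighborFinset w, g x.1 x.2
      = g w.1 (w.2 + 1) + g w.1 (w.2 - 1)
        + (if w.1.val + 1 < n ∧ w.2 = t (w.1.val + 1) then g (w.1.val + 1) 0 else 0)
        + (if 0 < w.1.val ∧ w.2 = 0 then g (w.1.val - 1) (t w.1.val) else 0) := by
  obtain ⟨l, j⟩ := w
  -- The three kinds of adjacency exclude each other, so the indicator of their disjunction is the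
  -- sum of the indicators.
  have hsplit : ∀ x : Fin n × Fin 5, (if (chainGraph n t).Adj (l, j) x then g x.1 x.2 else 0)
      = (if l = x.1 then (if (SimpleGraph.cycleGraph 5).Adj j x.2 then g x.1 x.2 else 0) else 0)
      + (if x.1.val = l.val + 1 then (if x.2 = 0 then
          (if j = t (l.val + 1) then g x.1 x.2 else 0) else 0) else 0)
      + (if l.val = x.1.val + 1 then (if x.2 = t (x.1.val + 1) then
          (if j = 0 then g x.1 x.2 else 0) else 0) else 0) := by
    intro x
    have h1 : l = x.1 → ¬ x.1.val = l.val + 1 := by rintro rfl; omega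
    have h2 : l = x.1 → ¬ l.val = x.1.val + 1 := by rintro rfl; omega
    have h3 : x.1.val = l.val + 1 → ¬ l.val = x.1.val + 1 := by omega
    simp only [chainGraph]
    grind
  rw [SimpleGraph.neighborFinset_eq_filter, Finset.sum_filter, Finset.sum_congr rfl fun x _ => hsplit x,
    Finset.sum_add_distrib, Finset.sum_add_distrib]
  congr 1
  · congr 1
    · rw [Fintype.sum_prod_type]
      simp [sum_cycle_adj, Finset.sum_ite_irrel]
    · rw [Fintype.sum_prod_type]
      simp only [Finset.sum_ite_irrel, Finset.sum_const_zero, Finset.sum_ite_eq',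
        Finset.mem_univ, if_true]
      by_cases hl : l.val + 1 < n
      · rw [Finset.sum_eq_single (⟨l.val + 1, hl⟩ : Fin n)]
        · simp [hl]
        · intro b _ hb
          rw [if_neg]
          intro h; exact hb (Fin.ext h)
        · simp
      · rw [if_neg (by tauto)]
        refine Finset.sum_eq_zero fun b _ => if_neg ?_
        have := b.2; omega
  · rw [Fintype.sum_prod_type]
    simp only [Finset.sum_ite_irrel, Finset.sum_const_zero, Finset.sum_ite_eq',
        Finset.mem_univ, if_true]
    by_cases hl : 0 < l.val
    · have hl' : l.val - 1 + 1 = l.val := by omega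
      rw [Finset.sum_eq_single (⟨l.val - 1, by omega⟩ : Fin n)]
      · simp [hl, hl']
      · intro b _ hb
        rw [if_neg]
        intro h; exact hb (Fin.ext (by simp; omega))
      · simp
    · rw [if_neg (by tauto)]
      refine Finset.sum_eq_zero fun b _ => if_neg ?_
      omega

theorem degree_chainGraph (n : ℕ) (t : ℕ → Fin 5) (w : Fin n × Fin 5) :
    ((chainGraph n t).degree w : ℝ) = 2
        + (if w.1.val + 1 < n ∧ w.2 = t (w.1.val + 1) then 1 else 0)
        + (if 0 < w.1.val ∧ w.2 = 0 then 1 else 0) := by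
  have h := sum_neighborFinset_chainGraph n t w fun _ _ => 1
  rw [Finset.sum_const, SimpleGraph.card_neighborFinset_eq_degree, nsmul_one] at h
  rw [h]; norm_num

theorem chainRes_comm (t : ℕ → Fin 5) (k : ℕ) (i : Fin 5) (l : ℕ) (j : Fin 5) :
    chainRes t k i l j = chainRes t l j k i := by
  unfold chainRes
  rcases lt_trichotomy k l with h | h | h
  · rw [if_neg h.ne, if_pos h, if_neg h.ne', if_neg h.not_gt]
  · rw [if_pos h, if_pos h.symm, pentagonRes_sub_comm]
  · rw [if_neg h.ne', if_neg h.not_gt, if_neg h.ne, if_pos h]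

theorem chainRes_self (t : ℕ → Fin 5) (k : ℕ) (i : Fin 5) : chainRes t k i k i = 0 := by
  simp [chainRes, pentagonRes_zero]

/-- Crossing the bridge after the pentagon `l`, away from the vertex `(k, i)`. -/
theorem chainRes_succ_of_le (t : ℕ → Fin 5) {k l : ℕ} (h : k ≤ l) (i : Fin 5) :
    chainRes t k i (l + 1) 0 = chainRes t k i l (t (l + 1)) + 1 := by
  unfold chainRes
  rcases h.eq_or_lt with rfl | h
  · simp [pentagonRes_zero, add_comm]
  · rw [if_neg (by omega), if_pos (by omega), if_neg (by omega), if_pos h, spine_succ,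
      pentagonRes_zero]
    ring

/-- Crossing the bridge after the pentagon `l`, towards the vertex `(k, i)`. -/
theorem chainRes_succ_of_lt (t : ℕ → Fin 5) {k l : ℕ} (h : l < k) (i : Fin 5) :
    chainRes t k i (l + 1) 0 = chainRes t k i l (t (l + 1)) - 1 := by
  unfold chainRes
  rcases (Nat.succ_le_of_lt h).eq_or_lt with rfl | h'
  · simp [pentagonRes_zero]
  · rw [if_neg (by omega), if_neg (by omega), if_neg (by omega), if_neg (by omega), spine_succ t (l+1),
      sub_self, pentagonRes_zero, zero_sub, ← zero_sub, pentagonRes_sub_comm, sub_zero]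
    ring

/-- Inside one pentagon the Laplacian of the resistance distance has a source at the vertex through
which the pentagon is entered. -/
theorem chainRes_cycle (t : ℕ → Fin 5) (k : ℕ) (i : Fin 5) (l : ℕ) (j : Fin 5) :
    2 * chainRes t k i l j - chainRes t k i l (j + 1) - chainRes t k i l (j - 1)
      = 2 / 5 - 2 * (if j = (if k = l then i else if k < l then 0 else t (l + 1)) then 1 else 0) := by
  have key : ∀ a : Fin 5, 2 * pentagonRes (j - a) - pentagonRes (j + 1 - a)
      - pentagonRes (j - 1 - a) = 2 / 5 - 2 * (if j = a then 1 else 0) := by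
    intro a
    rw [add_sub_right_comm, sub_right_comm j 1 a, pentagonRes_laplacian]
    simp only [sub_eq_zero]
  unfold chainRes
  rcases lt_trichotomy k l with h | h | h
  · simp only [h.ne, h, if_true, if_false]
    have := key 0
    simp only [sub_zero] at this
    linarith
  · simp only [h, if_true, pentagonRes_sub_comm i]
    exact key i
  · simp only [h.ne', h.not_gt, if_false]
    linarith [key (t (l + 1))]

/-- A bridge at `w` contributes -1 if it leads away from `u` and +1 if it leads towards `u`. In a
pentagon not containing `u`, the +1 at the entry vertex reduces the source -2 from `chainRes_cycle`
to -1, so every bridge end costs exactly 1, which is the degree term. Only the -2 at `u` itself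
depends on `u`. -/
theorem lapMatrix_mulVec_chainRes (n : ℕ) (t : ℕ → Fin 5) (u w : Fin n × Fin 5) :
    ((chainGraph n t).lapMatrix ℝ).mulVec (fun x => chainRes t u.1 u.2 x.1 x.2) w
      = 12 / 5 - (chainGraph n t).degree w - 2 * (Pi.single u 1 : Fin n × Fin 5 → ℝ) w := by
  rw [SimpleGraph.lapMatrix_mulVec_apply, sum_neighborFinset_chainGraph n t w (chainRes t u.1 u.2),
    degree_chainGraph]
  obtain ⟨⟨l, hl⟩, j⟩ := w
  obtain ⟨⟨k, hk⟩, i⟩ := u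
  have hc := chainRes_cycle t k i l j
  have hs : (Pi.single ((⟨k, hk⟩, i) : Fin n × Fin 5) 1 : Fin n × Fin 5 → ℝ) (⟨l, hl⟩, j)
      = if k = l ∧ j = i then 1 else 0 := by
    rw [Pi.single_apply]
    simp [eq_comm]
  rw [hs]
  have hup : k ≤ l → chainRes t k i (l + 1) 0 = chainRes t k i l (t (l + 1)) + 1 :=
    fun h => chainRes_succ_of_le t h i
  have hup' : l < k → chainRes t k i (l + 1) 0 = chainRes t k i l (t (l + 1)) - 1 :=
    fun h => chainRes_succ_of_lt t h i
  have hdn : 0 < l → k < l → chainRes t k i (l - 1) (t l) = chainRes t k i l 0 - 1 := by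
    intro h0 h
    obtain ⟨l, rfl⟩ := Nat.exists_eq_add_of_lt h0
    rw [zero_add, Nat.add_sub_cancel, chainRes_succ_of_le t (by omega) i]; ring
  have hdn' : 0 < l → l ≤ k → chainRes t k i (l - 1) (t l) = chainRes t k i l 0 + 1 := by
    intro h0 h
    obtain ⟨l, rfl⟩ := Nat.exists_eq_add_of_lt h0
    rw [zero_add, Nat.add_sub_cancel, chainRes_succ_of_lt t (by omega) i]; ring
  simp only
  have hb1 : (if l + 1 < n ∧ j = t (l + 1) then chainRes t k i (l + 1) 0 else 0)
      = (if l + 1 < n ∧ j = t (l + 1) then 1 else 0) *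
        (chainRes t k i l j + (if k ≤ l then 1 else -1)) := by
    split_ifs with h1 h2
    · rw [hup h2, h1.2]; ring
    · rw [hup' (by omega), h1.2]; ring
    · simp
    · simp
  have hb2 : (if 0 < l ∧ j = 0 then chainRes t k i (l - 1) (t l) else 0)
      = (if 0 < l ∧ j = 0 then 1 else 0) *
        (chainRes t k i l j + (if k < l then -1 else 1)) := by
    split_ifs with h1 h2
    · rw [hdn h1.1 h2, h1.2]; ring
    · rw [hdn' h1.1 (by omega), h1.2]; ring
    · simp
    · simp
  rw [hb1, hb2]
  rcases lt_trichotomy k l with h | h | h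
  · have h0 : 0 < l := by omega
    simp only [h.ne, h, h.le, h0, if_true, if_false, true_and, false_and] at hc ⊢
    split_ifs at hc ⊢ <;> linarith
  · simp only [h, le_refl, lt_irrefl, if_true, if_false, true_and] at hc ⊢
    split_ifs at hc ⊢ <;> linarith
  · have h1 : l + 1 < n := by omega
    simp only [h.ne', h.not_gt, h.not_ge, h1, if_false, true_and, false_and] at hc ⊢
    split_ifs at hc ⊢ <;> linarith

theorem resistanceDist_chainGraph (n : ℕ) (t : ℕ → Fin 5) (u v : Fin n × Fin 5) :
    resistanceDist (chainGraph n t) u v = chainRes t u.1 u.2 v.1 v.2 := by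
  have hpot : IsUnitPotential (chainGraph n t) u v
      ((1 / 2 : ℝ) • ((fun x => chainRes t v.1 v.2 x.1 x.2)
        - fun x => chainRes t u.1 u.2 x.1 x.2)) := by
    unfold IsUnitPotential
    ext w
    rw [Matrix.mulVec_smul, Matrix.mulVec_sub, Pi.smul_apply, Pi.sub_apply,
      lapMatrix_mulVec_chainRes, lapMatrix_mulVec_chainRes, Pi.sub_apply, smul_eq_mul]
    ring
  rw [resistanceDist_eq hpot]
  simp only [Pi.smul_apply, Pi.sub_apply, smul_eq_mul, chainRes_self]
  rw [chainRes_comm t v.1 v.2 u.1 u.2]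
  ring

/-! ### Summing the resistances to obtain the index. -/

theorem sum_chainRes_right (t : ℕ → Fin 5) (k : ℕ) (i : Fin 5) (l : ℕ) :
    ∑ j, chainRes t k i l j =
      if k = l then 4
      else if k < l then 5 * (spine t l - spine t (k + 1) + 1 + pentagonRes (i - t (k + 1))) + 4
      else 5 * (spine t k - spine t (l + 1) + 1 + pentagonRes i) + 4 := by
  unfold chainRes
  split_ifs
  · exact sum_pentagonRes_sub' i
  · rw [Finset.sum_add_distrib, sum_pentagonRes]; simp; ring
  · simp only [Finset.sum_add_distrib, sum_pentagonRes_sub]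
    simp; ring

/-- For distinct pentagons 65 = 25 + 20 + 20: the extra bridge for each of the 25 pairs, and at
either end five copies of the total 4 of `sum_pentagonRes`. -/
theorem sum_sum_chainRes (t : ℕ → Fin 5) (k l : ℕ) :
    ∑ i, ∑ j, chainRes t k i l j =
      if k = l then 20
      else if k < l then 25 * (spine t l - spine t (k + 1)) + 65
      else 25 * (spine t k - spine t (l + 1)) + 65 := by
  simp only [sum_chainRes_right]
  split_ifs
  · norm_num
  · simp only [Finset.sum_add_distrib, ← Finset.mul_sum, sum_pentagonRes_sub]
    simp; ring
  · simp only [Finset.sum_add_distrib, ← Finset.mul_sum, sum_pentagonRes]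
    simp; ring

/-- The resistance distances from the two ends of a bridge to the vertices of one pentagon. -/
theorem sum_chainRes_bridge (t : ℕ → Fin 5) (b l : ℕ) :
    ∑ j, chainRes t b (t (b + 1)) l j + ∑ j, chainRes t (b + 1) 0 l j =
      if b < l then 10 * (spine t l - spine t (b + 1)) + 13
      else 10 * (spine t (b + 1) - spine t (l + 1)) + 13 := by
  simp only [sum_chainRes_right]
  rcases lt_trichotomy b l with h | rfl | h
  · rw [if_neg h.ne, if_pos h, if_pos h, sub_self, pentagonRes_zero]
    -- For `l = b + 1` the second sum stays inside one pentagon, yet the same formula holds: 9 + 4 =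
    -- 13.
    rcases (Nat.succ_le_of_lt h).eq_or_lt with rfl | h'
    · rw [if_pos rfl]; ring
    · rw [if_neg h'.ne, if_pos h', spine_succ t (b + 1), zero_sub, ← zero_sub,
        pentagonRes_sub_comm, sub_zero]
      ring
  · simp [pentagonRes_zero]; ring
  · rw [if_neg h.ne', if_neg h.not_gt, if_neg h.not_gt, if_neg (by omega), if_neg (by omega),
      spine_succ t b, pentagonRes_zero]
    ring

theorem sum_range_sum_range_succ (f : ℕ → ℕ → ℝ) (n : ℕ) :
    ∑ k ∈ Finset.range (n + 1), ∑ l ∈ Finset.range (n + 1), f k l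
      = ∑ k ∈ Finset.range n, ∑ l ∈ Finset.range n, f k l
        + ∑ k ∈ Finset.range n, (f k n + f n k) + f n n := by
  simp only [Finset.sum_range_succ, Finset.sum_add_distrib]
  ring

/-- Each degree is 2 plus the number `β` of bridge ends at the vertex. The 2's give the double sum
over pentagons, and by symmetry the `β`'s give a single sum over bridge ends, grouped by bridge. -/
theorem additiveDegreeKirchhoff_chainGraph (N : ℕ) (t : ℕ → Fin 5) :
    additiveDegreeKirchhoff (chainGraph (N + 1) t)
      = 2 * ∑ k ∈ Finset.range (N + 1), ∑ l ∈ Finset.range (N + 1), ∑ i, ∑ j, chainRes t k i l j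
        + ∑ b ∈ Finset.range N, ∑ l ∈ Finset.range (N + 1),
          (∑ j, chainRes t b (t (b + 1)) l j + ∑ j, chainRes t (b + 1) 0 l j) := by
  let R : Fin (N + 1) × Fin 5 → Fin (N + 1) × Fin 5 → ℝ := fun u v => chainRes t u.1 u.2 v.1 v.2
  let β : Fin (N + 1) × Fin 5 → ℝ := fun w =>
    (if w.1.val + 1 < N + 1 ∧ w.2 = t (w.1.val + 1) then 1 else 0)
      + (if 0 < w.1.val ∧ w.2 = 0 then 1 else 0)
  have hdeg : ∀ w, ((chainGraph (N + 1) t).degree w : ℝ) = 2 + β w := by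
    intro w
    rw [degree_chainGraph, add_assoc]
  have hsymm : ∑ u, ∑ v, β v * R u v = ∑ u, ∑ v, β u * R u v := by
    rw [Finset.sum_comm]
    refine Finset.sum_congr rfl fun u _ => Finset.sum_congr rfl fun v _ => ?_
    simp only [R, chainRes_comm t v.1 v.2 u.1 u.2]
  have h1 : additiveDegreeKirchhoff (chainGraph (N + 1) t)
      = 2 * ∑ u, ∑ v, R u v + ∑ u, ∑ v, β u * R u v := by
    have : ∀ u v, ((chainGraph (N + 1) t).degree u + (chainGraph (N + 1) t).degree v : ℝ)
        * resistanceDist (chainGraph (N + 1) t) u v = 4 * R u v + β u * R u v + β v * R u v := by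
      intro u v
      rw [hdeg, hdeg, resistanceDist_chainGraph]
      simp only [R]; ring
    simp only [additiveDegreeKirchhoff, this, Finset.sum_add_distrib, hsymm, ← Finset.mul_sum]
    ring
  rw [h1]
  congr 1
  · congr 1
    simp only [Fintype.sum_prod_type, R]
    rw [Finset.sum_range]
    refine Finset.sum_congr rfl fun k _ => ?_
    rw [Finset.sum_range, Finset.sum_comm]
  · have hrow : ∀ u, ∑ v, β u * R u v
        = β u * ∑ l ∈ Finset.range (N + 1), ∑ j, chainRes t u.1 u.2 l j := by
      intro u
      rw [← Finset.mul_sum, Fintype.sum_prod_type, Finset.sum_range]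
    have hblock : ∀ k : Fin (N + 1), ∑ i, β (k, i) *
          ∑ l ∈ Finset.range (N + 1), ∑ j, chainRes t k i l j
        = (if k.val < N then ∑ l ∈ Finset.range (N + 1), ∑ j, chainRes t k (t (k + 1)) l j else 0)
          + (if 0 < k.val then ∑ l ∈ Finset.range (N + 1), ∑ j, chainRes t k 0 l j else 0) := by
      intro k
      simp only [β, add_mul, ite_mul, one_mul, zero_mul, Finset.sum_add_distrib, ite_and,
        Finset.sum_ite_irrel, Finset.sum_const_zero, Finset.sum_ite_eq', Finset.mem_univ, if_true,
        Nat.add_lt_add_iff_right]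
    simp only [hrow]
    rw [Fintype.sum_prod_type]
    simp only [hblock]
    -- Left ends omit the last pentagon and right ends the first; shifting the latter by one indexes
    -- both by the bridge `b`.
    rw [← Finset.sum_range fun k =>
        (if k < N then ∑ l ∈ Finset.range (N + 1), ∑ j, chainRes t k (t (k + 1)) l j else 0)
          + (if 0 < k then ∑ l ∈ Finset.range (N + 1), ∑ j, chainRes t k 0 l j else 0),
      Finset.sum_add_distrib, Finset.sum_range_succ,
      Finset.sum_range_succ' fun k => if 0 < k then _ else _]
    simp only [lt_irrefl, if_false, add_zero, Nat.succ_pos, if_true, Finset.sum_add_distrib]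
    congr 1
    exact Finset.sum_congr rfl fun k hk => if_pos (Finset.mem_range.1 hk)

/-- Abel summation. The crossing towards u_{m+1} gets weight `m`, so the arbitrary vertex u_1 drops
out. -/
theorem sum_spine_succ (t : ℕ → Fin 5) (n : ℕ) :
    ∑ k ∈ Finset.range n, spine t (k + 1)
      = n * spine t n - ∑ m ∈ Finset.range n, (m : ℝ) * (1 + pentagonRes (t (m + 1))) := by
  induction n with
  | zero => simp
  | succ n ih =>
    rw [Finset.sum_range_succ, ih, Finset.sum_range_succ, spine_succ]
    push_cast; ring

/-- Induction on the chain. A new pentagon interacts with the old pentagons (`h1`), with the old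
bridges (`h2`), and brings a bridge seen from all pentagons (`h3`); each is a multiple of the same
weighted sum, and 2·50 + 10 + 10 = 120. -/
theorem additiveDegreeKirchhoff_chainGraph_eq_sum (N : ℕ) (t : ℕ → Fin 5) :
    additiveDegreeKirchhoff (chainGraph (N + 1) t)
      = 40 + ∑ q ∈ Finset.range N, (326 + 286 * (q : ℝ)
        + 120 * ∑ m ∈ Finset.range (q + 1), (m : ℝ) * (1 + pentagonRes (t (m + 1)))) := by
  rw [additiveDegreeKirchhoff_chainGraph]
  simp only [sum_sum_chainRes, sum_chainRes_bridge]
  induction N with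
  | zero => norm_num
  | succ N ih =>
    rw [sum_range_sum_range_succ _ (N + 1), Finset.sum_range_succ (fun b =>
        ∑ l ∈ Finset.range (N + 1 + 1), if b < l then 10 * (spine t l - spine t (b + 1)) + 13
          else 10 * (spine t (b + 1) - spine t (l + 1)) + 13) N,
      Finset.sum_range_succ (fun q : ℕ => 326 + 286 * (q : ℝ) + _) N]
    have h1 : ∑ k ∈ Finset.range (N + 1),
        ((if k = N + 1 then (20 : ℝ) else if k < N + 1
          then 25 * (spine t (N + 1) - spine t (k + 1)) + 65
          else 25 * (spine t k - spine t (N + 1 + 1)) + 65)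
        + (if N + 1 = k then (20 : ℝ) else if N + 1 < k
          then 25 * (spine t k - spine t (N + 1 + 1)) + 65
          else 25 * (spine t (N + 1) - spine t (k + 1)) + 65))
        = 50 * ∑ m ∈ Finset.range (N + 1), (m : ℝ) * (1 + pentagonRes (t (m + 1)))
          + 130 * (N + 1) := by
      have : ∀ k ∈ Finset.range (N + 1),
        ((if k = N + 1 then (20 : ℝ) else if k < N + 1
          then 25 * (spine t (N + 1) - spine t (k + 1)) + 65
          else 25 * (spine t k - spine t (N + 1 + 1)) + 65)
        + (if N + 1 = k then (20 : ℝ) else if N + 1 < k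
          then 25 * (spine t k - spine t (N + 1 + 1)) + 65
          else 25 * (spine t (N + 1) - spine t (k + 1)) + 65))
        = 50 * spine t (N + 1) + 130 - 50 * spine t (k + 1) := by
        intro k hk
        have := Finset.mem_range.1 hk
        rw [if_neg (by omega), if_pos this, if_neg (by omega), if_neg (by omega)]
        ring
      rw [Finset.sum_congr rfl this, Finset.sum_sub_distrib, ← Finset.mul_sum, sum_spine_succ]
      simp only [Finset.sum_const, Finset.card_range, nsmul_eq_mul]
      push_cast; ring
    have h2 : ∑ b ∈ Finset.range N, ∑ l ∈ Finset.range (N + 1 + 1),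
          (if b < l then 10 * (spine t l - spine t (b + 1)) + 13
            else 10 * (spine t (b + 1) - spine t (l + 1)) + 13)
        = ∑ b ∈ Finset.range N, ∑ l ∈ Finset.range (N + 1),
          (if b < l then 10 * (spine t l - spine t (b + 1)) + 13
            else 10 * (spine t (b + 1) - spine t (l + 1)) + 13)
          + (10 * ∑ m ∈ Finset.range (N + 1), (m : ℝ) * (1 + pentagonRes (t (m + 1)))
            + 13 * N) := by
      have : ∀ b ∈ Finset.range N, (if b < N + 1 then 10 * (spine t (N + 1) - spine t (b + 1)) + 13
            else 10 * (spine t (b + 1) - spine t (N + 1 + 1)) + 13)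
          = 10 * spine t (N + 1) + 13 - 10 * spine t (b + 1) := by
        intro b hb
        have := Finset.mem_range.1 hb
        rw [if_pos (by omega)]
        ring
      -- The sum runs over `b < N` only; the missing term `b = N` is split off from the identity for
      -- `N + 1`.
      have hs := sum_spine_succ t (N + 1)
      rw [Finset.sum_range_succ] at hs
      simp only [Finset.sum_range_succ _ (N + 1)]
      rw [Finset.sum_add_distrib, Finset.sum_congr rfl this, Finset.sum_sub_distrib,
        ← Finset.mul_sum, eq_sub_of_add_eq hs]
      simp only [Finset.sum_const, Finset.card_range, nsmul_eq_mul]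
      push_cast; ring
    have h3 : ∑ l ∈ Finset.range (N + 1 + 1),
          (if N < l then 10 * (spine t l - spine t (N + 1)) + 13
            else 10 * (spine t (N + 1) - spine t (l + 1)) + 13)
        = 10 * ∑ m ∈ Finset.range (N + 1), (m : ℝ) * (1 + pentagonRes (t (m + 1)))
            + 13 * (N + 2) := by
      have : ∀ l ∈ Finset.range (N + 1), (if N < l then 10 * (spine t l - spine t (N + 1)) + 13
            else 10 * (spine t (N + 1) - spine t (l + 1)) + 13)
          = 10 * spine t (N + 1) + 13 - 10 * spine t (l + 1) := by
        intro l hl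
        have := Finset.mem_range.1 hl
        rw [if_neg (by omega)]
        ring
      rw [Finset.sum_range_succ, Finset.sum_congr rfl this, Finset.sum_sub_distrib,
        ← Finset.mul_sum, sum_spine_succ, if_pos (Nat.lt_succ_self N)]
      simp only [Finset.sum_const, Finset.card_range, nsmul_eq_mul]
      push_cast; ring
    rw [h1, h2, h3, if_pos rfl]
    linarith [ih]

/-- Interchange of summation: the term `m = i + 1` occurs for the N - 1 - i values q = i + 1, …, N -
1, and the term `m = 0` vanishes. -/
theorem sum_range_sum_range_mul (f : ℕ → ℝ) (N : ℕ) :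
    ∑ q ∈ Finset.range N, ∑ m ∈ Finset.range (q + 1), (m : ℝ) * f m
      = ∑ i ∈ Finset.range N, ((i : ℝ) + 1) * (N - 1 - i) * f (i + 1) := by
  induction N with
  | zero => simp
  | succ N ih =>
    rw [Finset.sum_range_succ, ih, Finset.sum_range_succ', Finset.sum_range_succ]
    have : ∀ i ∈ Finset.range N, ((i : ℝ) + 1) * (((N + 1 : ℕ) : ℝ) - 1 - i) * f (i + 1)
        = ((i : ℝ) + 1) * (N - 1 - i) * f (i + 1) + ((i + 1 : ℕ) : ℝ) * f (i + 1) := by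
      intro i _
      push_cast; ring
    rw [Finset.sum_congr rfl this, Finset.sum_add_distrib]
    push_cast; ring

/-- The additive degree-Kirchhoff index of the chain as an affine function of the steps of the
second kind. -/
theorem exists_additiveDegreeKirchhoff_chainGraph (N : ℕ) : ∃ A : ℝ, ∀ (t : ℕ → Fin 5) (z : ℕ → ℝ),
    (∀ m, 2 ≤ m → (z m = 0 ∧ (t m = 1 ∨ t m = 4)) ∨ (z m = 1 ∧ (t m = 2 ∨ t m = 3))) →
    additiveDegreeKirchhoff (chainGraph (N + 1) t)
      = A + ∑ i ∈ Finset.range N, 48 * (((i : ℝ) + 1) * (N - 1 - i)) * z (i + 2) := by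
  -- The crossing resistance is 4/5 + (2/5)z, whence 216 = 120(1 + 4/5) and 48 = 120 · 2/5.
  refine ⟨40 + ∑ q ∈ Finset.range N, (326 + 286 * (q : ℝ)) + ∑ i ∈ Finset.range N,
    216 * (((i : ℝ) + 1) * (N - 1 - i)), fun t z h => ?_⟩
  have hsum : ∑ i ∈ Finset.range N, 120 * (((i : ℝ) + 1) * (N - 1 - i)
        * (1 + pentagonRes (t (i + 1 + 1))))
      = ∑ i ∈ Finset.range N, 216 * (((i : ℝ) + 1) * (N - 1 - i))
        + ∑ i ∈ Finset.range N, 48 * (((i : ℝ) + 1) * (N - 1 - i)) * z (i + 2) := by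
    rw [← Finset.sum_add_distrib]
    refine Finset.sum_congr rfl fun i _ => ?_
    have hz : pentagonRes (t (i + 1 + 1)) = 4 / 5 + 2 / 5 * z (i + 2) := by
      rw [show i + 1 + 1 = i + 2 from rfl]
      rcases h (i + 2) (by omega) with ⟨hz, ht | ht⟩ | ⟨hz, ht | ht⟩ <;> rw [hz, ht]
      · rw [pentagonRes_one]; norm_num
      · rw [pentagonRes_four]; norm_num
      · rw [pentagonRes_two]; norm_num
      · rw [pentagonRes_three]; norm_num
    rw [hz]
    ring
  rw [additiveDegreeKirchhoff_chainGraph_eq_sum, Finset.sum_add_distrib, ← Finset.mul_sum,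
    sum_range_sum_range_mul (fun m => 1 + pentagonRes (t (m + 1))), Finset.mul_sum, hsum]
  ring

theorem sum_sq_weights (N : ℕ) :
    ∑ i ∈ Finset.range N, (((i : ℝ) + 1) * (N - 1 - i)) ^ 2 = ((N : ℝ) ^ 5 - N) / 30 := by
  -- The `N` inside the weight is freed as `x`, so that induction on the range leaves the summand
  -- fixed.
  have key : ∀ (x : ℝ) (n : ℕ), ∑ i ∈ Finset.range n, (((i : ℝ) + 1) * (x - 1 - i)) ^ 2
      = x ^ 2 * (n * (n + 1) * (2 * n + 1) / 6) - 2 * x * (n ^ 2 * (n + 1) ^ 2 / 4)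
        + n * (n + 1) * (2 * n + 1) * (3 * n ^ 2 + 3 * n - 1) / 30 := by
    intro x n
    induction n with
    | zero => simp
    | succ n ih =>
      rw [Finset.sum_range_succ, ih]
      push_cast; ring
  rw [key]
  ring

/-! ### Uniform convergence of distribution functions. -/

/-- **Pólya's theorem**: pointwise convergence of distribution functions to a continuous distribution
function is uniform. -/
theorem tendsto_iSup_abs_sub_of_monotone {F : ℕ → ℝ → ℝ} {G : ℝ → ℝ} (hF : ∀ n, Monotone (F n))
    (hF0 : ∀ n a, 0 ≤ F n a) (hF1 : ∀ n a, F n a ≤ 1) (hG : Monotone G) (hGc : Continuous G)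
    (hGbot : Tendsto G atBot (𝓝 0)) (hGtop : Tendsto G atTop (𝓝 1))
    (h : ∀ a, Tendsto (fun n => F n a) atTop (𝓝 (G a))) :
    Tendsto (fun n => ⨆ a, |F n a - G a|) atTop (𝓝 0) := by
  have hG0 : ∀ a, 0 ≤ G a := fun a => hG.le_of_tendsto hGbot a
  have hG1 : ∀ a, G a ≤ 1 := fun a => hG.ge_of_tendsto hGtop a
  have hsurj : ∀ y, 0 < y → y < 1 → ∃ x, G x = y := by
    intro y h0 h1
    obtain ⟨a, ha⟩ := (hGbot.eventually (gt_mem_nhds h0)).exists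
    obtain ⟨b, hb⟩ := (hGtop.eventually (lt_mem_nhds h1)).exists
    exact mem_range_of_exists_le_of_exists_ge hGc ⟨a, ha.le⟩ ⟨b, hb.le⟩
  rw [Metric.tendsto_atTop']
  intro ε hε
  obtain ⟨K, hK⟩ := exists_nat_gt (4 / ε)
  have hK0 : (0 : ℝ) < K := lt_trans (by positivity) hK
  have hKε : 1 / (K : ℝ) < ε / 4 := by
    rw [div_lt_iff₀ hε] at hK
    rw [div_lt_div_iff₀ hK0 (by norm_num)]
    linarith
  -- `G` need not attain 0 or 1, so only interior levels get a grid point; the bounds 0 ≤ F ≤ 1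
  -- replace the two ends.
  have hgrid : ∀ k : ℕ, ∃ x, 0 < k → k < K → G x = k / K := by
    intro k
    by_cases hk : 0 < k ∧ k < K
    · obtain ⟨x, hx⟩ := hsurj (k / K) (div_pos (by exact_mod_cast hk.1) hK0)
        ((div_lt_one hK0).2 (by exact_mod_cast hk.2))
      exact ⟨x, fun _ _ => hx⟩
    · exact ⟨0, fun h1 h2 => absurd ⟨h1, h2⟩ hk⟩
  choose x hx using hgrid
  have hev : ∀ᶠ n in atTop, ∀ k ∈ Finset.range K, |F n (x k) - G (x k)| < ε / 4 := by
    rw [Filter.eventually_all_finset]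
    intro k _
    have := (Metric.tendsto_nhds.1 (h (x k))) (ε / 4) (by positivity)
    simpa [Real.dist_eq] using this
  obtain ⟨n₀, hn₀⟩ := eventually_atTop.1 hev
  refine ⟨n₀, fun n hn => ?_⟩
  have hgrid := hn₀ n hn.le
  have hbound : ∀ a, |F n a - G a| ≤ ε / 2 := by
    intro a
    have hmul : G a * K / K = G a := by field_simp
    rw [abs_le]
    constructor
    · by_cases hk : ⌈G a * K⌉₊ ≤ 1
      · have h1 : G a * K ≤ 1 := by
          have := Nat.le_ceil (G a * K)
          have h2 : ((⌈G a * K⌉₊ : ℕ) : ℝ) ≤ 1 := by exact_mod_cast hk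
          linarith
        have h2 : G a ≤ 1 / K := by rwa [le_div_iff₀ hK0]
        linarith [hF0 n a]
      -- The ceiling yields k/K < G a ≤ (k + 1)/K; strictness on the left is what puts the grid
      -- point below `a`.
      · obtain ⟨k, hk'⟩ : ∃ k, ⌈G a * K⌉₊ = k + 1 := ⟨⌈G a * K⌉₊ - 1, by omega⟩
        have hk0 : 0 < k := by omega
        have h1 : (k : ℝ) < G a * K := Nat.lt_ceil.1 (by omega)
        have h2 : G a * K ≤ k + 1 := by
          have := Nat.le_ceil (G a * K)
          rw [hk'] at this
          exact_mod_cast this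
        have hkK : k < K := by
          have : (k : ℝ) < K := h1.trans_le (mul_le_of_le_one_left hK0.le (hG1 a))
          exact_mod_cast this
        have hxk := hx k hk0 hkK
        have hlt : x k < a := by
          refine hG.reflect_lt ?_
          rw [hxk, div_lt_iff₀ hK0]; exact h1
        have h3 := (abs_lt.1 (hgrid k (Finset.mem_range.2 hkK))).1
        have h4 := hF n hlt.le
        have h5 : G a ≤ k / K + 1 / K := by
          rw [← add_div, le_div_iff₀ hK0]; exact h2
        rw [hxk] at h3
        linarith
    · have hfl := Nat.floor_le (mul_nonneg (hG0 a) hK0.le)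
      have hfl' := Nat.lt_floor_add_one (G a * K)
      have h5 : ((⌊G a * K⌋₊ : ℕ) : ℝ) / K ≤ G a := by
        rw [div_le_iff₀ hK0]; exact hfl
      by_cases hk : ⌊G a * K⌋₊ + 1 < K
      · have hxk := hx _ (Nat.succ_pos _) hk
        push_cast at hxk
        have hlt : a < x (⌊G a * K⌋₊ + 1) := by
          refine hG.reflect_lt ?_
          rw [hxk, lt_div_iff₀ hK0]; exact hfl'
        have h3 := (abs_lt.1 (hgrid _ (Finset.mem_range.2 hk))).2
        have h4 := hF n hlt.le
        rw [hxk, add_div] at h3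
        linarith
      · have h6 : (K : ℝ) ≤ ⌊G a * K⌋₊ + 1 := by exact_mod_cast not_lt.1 hk
        have h7 : 1 ≤ ((⌊G a * K⌋₊ : ℕ) : ℝ) / K + 1 / K := by
          rw [← add_div, le_div_iff₀ hK0]; linarith
        linarith [hF1 n a]
  rw [Real.dist_0_eq_abs, abs_of_nonneg (Real.iSup_nonneg fun a => abs_nonneg _)]
  exact (ciSup_le hbound).trans_lt (by linarith)

/-! ### Central limit theorem for weighted sums. -/

/-- Replace the factors one at a time; the untouched factors have norm at most 1. -/
theorem norm_prod_sub_prod_le_sum {ι : Type*} (s : Finset ι) (f g : ι → ℂ)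
    (hf : ∀ i ∈ s, ‖f i‖ ≤ 1) (hg : ∀ i ∈ s, ‖g i‖ ≤ 1) :
    ‖∏ i ∈ s, f i - ∏ i ∈ s, g i‖ ≤ ∑ i ∈ s, ‖f i - g i‖ := by
  classical
  induction s using Finset.induction_on with
  | empty => simp
  | insert a s ha ih =>
    rw [Finset.prod_insert ha, Finset.prod_insert ha, Finset.sum_insert ha]
    have hs := ih (fun i hi => hf i (Finset.mem_insert_of_mem hi))
      (fun i hi => hg i (Finset.mem_insert_of_mem hi))
    have hga := hg a (Finset.mem_insert_self a s)
    have hfs : ‖∏ i ∈ s, f i‖ ≤ 1 := by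
      rw [norm_prod]
      exact Finset.prod_le_one (fun _ _ => norm_nonneg _)
        (fun i hi => hf i (Finset.mem_insert_of_mem hi))
    calc ‖f a * ∏ i ∈ s, f i - g a * ∏ i ∈ s, g i‖
        = ‖(f a - g a) * ∏ i ∈ s, f i + g a * (∏ i ∈ s, f i - ∏ i ∈ s, g i)‖ := by
          congr 1; ring
      _ ≤ ‖f a - g a‖ * ‖∏ i ∈ s, f i‖ + ‖g a‖ * ‖∏ i ∈ s, f i - ∏ i ∈ s, g i‖ := by
          refine (norm_add_le _ _).trans ?_
          rw [norm_mul, norm_mul]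
      _ ≤ ‖f a - g a‖ + ∑ i ∈ s, ‖f i - g i‖ := by
          refine add_le_add (mul_le_of_le_one_right (norm_nonneg _) hfs) ?_
          exact (mul_le_of_le_one_left (norm_nonneg _) hga).trans hs

section WeightedCLT

variable {Ω : Type*} [MeasurableSpace Ω] {P : Measure Ω} [IsProbabilityMeasure P]

/-- Equal mean and variance give both characteristic functions the same second-order Taylor
polynomial at 0. -/
theorem charFun_sub_charFun_gaussianReal_isLittleO {X : Ω → ℝ} (hX : AEMeasurable X P)
    (h0 : ∫ ω, X ω ∂P = 0) (h1 : ∫ ω, X ω ^ 2 ∂P = 1) :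
    (fun t => charFun (P.map X) t - charFun (gaussianReal 0 1) t) =o[𝓝 0] fun t => t ^ 2 := by
  have hg := taylor_charFun_two (P := gaussianReal 0 1) (X := fun x => x) aemeasurable_id
    (by exact integral_id_gaussianReal)
    (by
      have h := variance_fun_id_gaussianReal (μ := 0) (v := 1)
      rw [variance_eq_integral aemeasurable_id'] at h
      simpa [integral_id_gaussianReal] using h)
  have := (taylor_charFun_two hX h0 h1).sub hg
  simpa using this

/-- The central limit theorem for weighted sums of independent, identically distributed variables
with uniformly small weights, in terms of characteristic functions. -/
theorem tendsto_charFun_weighted_sum {ξ : ℕ → Ω → ℝ} (hindep : iIndepFun ξ P)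
    (hident : ∀ i, IdentDistrib (ξ i) (ξ 0) P P) (h0 : ∫ ω, ξ 0 ω ∂P = 0)
    (h1 : ∫ ω, ξ 0 ω ^ 2 ∂P = 1) (w : ℕ → ℕ → ℝ)
    (hw : ∀ᶠ n in atTop, ∑ i ∈ Finset.range n, w n i ^ 2 = 1)
    (hsmall : ∀ δ > 0, ∀ᶠ n in atTop, ∀ i ∈ Finset.range n, |w n i| < δ) (t : ℝ) :
    Tendsto (fun n => charFun (P.map fun ω => ∑ i ∈ Finset.range n, w n i * ξ i ω) t) atTop
      (𝓝 (charFun (gaussianReal 0 1) t)) := by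
  have hm : ∀ i, AEMeasurable (ξ i) P := fun i => (hident i).aemeasurable_fst
  have hprod : ∀ n, charFun (P.map fun ω => ∑ i ∈ Finset.range n, w n i * ξ i ω) t
      = ∏ i ∈ Finset.range n, charFun (P.map (ξ 0)) (w n i * t) := by
    intro n
    have hind : iIndepFun (fun i ω => w n i * ξ i ω) P :=
      hindep.comp (fun i x => w n i * x) fun i => measurable_const_mul _
    rw [(hind.restrict _).charFun_map_fun_finsetSum_eq_prod fun i _ => (hm i).const_mul _,
      Finset.prod_apply]
    refine Finset.prod_congr rfl fun i _ => ?_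
    rw [charFun_map_mul_comp (hm i), (hident i).map_eq]
  -- Since the squared weights sum to 1, the Gaussian characteristic function factors along the same
  -- weights and can be compared factor by factor.
  have hgauss : ∀ n, ∑ i ∈ Finset.range n, w n i ^ 2 = 1 → charFun (gaussianReal 0 1) t
      = ∏ i ∈ Finset.range n, charFun (gaussianReal 0 1) (w n i * t) := by
    intro n hn
    simp only [charFun_gaussianReal, ← Complex.exp_sum]
    congr 1
    simp only [Complex.ofReal_zero, mul_zero, zero_mul, NNReal.coe_one, Complex.ofReal_one, one_mul,
      zero_sub, Complex.ofReal_mul, Finset.sum_neg_distrib, ← Finset.sum_div, mul_pow,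
      ← Finset.sum_mul]
    rw [show ∑ i ∈ Finset.range n, (w n i : ℂ) ^ 2 = 1 by exact_mod_cast hn, one_mul]
  have : IsProbabilityMeasure (P.map (ξ 0)) := Measure.isProbabilityMeasure_map (hm 0)
  rw [Metric.tendsto_nhds]
  intro ε hε
  have ho := (charFun_sub_charFun_gaussianReal_isLittleO (hm 0) h0 h1).def
    (show 0 < ε / (2 * (t ^ 2 + 1)) by positivity)
  obtain ⟨δ, hδ, hball⟩ := Metric.eventually_nhds_iff.1 ho
  filter_upwards [hw, hsmall (δ / (|t| + 1)) (by positivity)] with n hn hs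
  rw [dist_eq_norm, hprod, hgauss n hn]
  calc _ ≤ ∑ i ∈ Finset.range n, ‖charFun (P.map (ξ 0)) (w n i * t)
          - charFun (gaussianReal 0 1) (w n i * t)‖ :=
        norm_prod_sub_prod_le_sum _ _ _ (fun _ _ => norm_charFun_le_one _)
          (fun _ _ => norm_charFun_le_one _)
    _ ≤ ∑ i ∈ Finset.range n, ε / (2 * (t ^ 2 + 1)) * (w n i ^ 2 * t ^ 2) := by
        refine Finset.sum_le_sum fun i hi => ?_
        have hlt : dist (w n i * t) 0 < δ := by
          rw [Real.dist_0_eq_abs, abs_mul]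
          have h2 := hs i hi
          rw [lt_div_iff₀ (by positivity)] at h2
          nlinarith [abs_nonneg (w n i)]
        have := hball hlt
        rwa [Real.norm_of_nonneg (sq_nonneg _), mul_pow] at this
    _ = ε * (t ^ 2 / (2 * (t ^ 2 + 1))) := by
        rw [← Finset.mul_sum, ← Finset.sum_mul, hn]
        ring
    _ < ε := by
        refine mul_lt_of_lt_one_right hε ?_
        rw [div_lt_one (by positivity)]
        nlinarith [sq_nonneg t]

/-- Convergence of characteristic functions to the one of the standard normal law implies
uniform convergence of distribution functions. -/
theorem tendsto_iSup_of_tendsto_charFun {X : ℕ → Ω → ℝ} (hX : ∀ n, Measurable (X n))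
    (h : ∀ t, Tendsto (fun n => charFun (P.map (X n)) t) atTop
      (𝓝 (charFun (gaussianReal 0 1) t))) :
    Tendsto (fun n => ⨆ a : ℝ, |P.real {ω | X n ω ≤ a}
      - ∫ x in Set.Iic a, (1 / Real.sqrt (2 * Real.pi)) * Real.exp (-(x ^ 2) / 2)|)
      atTop (𝓝 0) := by
  have hint : ∀ a : ℝ, ∫ x in Set.Iic a, (1 / Real.sqrt (2 * Real.pi)) * Real.exp (-(x ^ 2) / 2)
      = cdf (gaussianReal 0 1) a := by
    intro a
    rw [cdf_eq_real, measureReal_def, gaussianReal_apply_eq_integral 0 one_ne_zero,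
      ENNReal.toReal_ofReal (integral_nonneg fun x => gaussianPDFReal_nonneg 0 1 x)]
    refine integral_congr_ae (Eventually.of_forall fun x => ?_)
    simp [gaussianPDFReal]
  have hlaw : ∀ n a, P.real {ω | X n ω ≤ a} = (P.map (X n)).real (Set.Iic a) := by
    intro n a
    rw [map_measureReal_apply (hX n) measurableSet_Iic]
    rfl
  have hprob : ∀ n, IsProbabilityMeasure (P.map (X n)) :=
    fun n => Measure.isProbabilityMeasure_map (hX n).aemeasurable
  simp only [hint, hlaw]
  have hatom : NullSingletonClass (gaussianReal 0 1) :=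
    nullSingletonClass_gaussianReal one_ne_zero
  let μ : ℕ → ProbabilityMeasure ℝ := fun n => ⟨P.map (X n), hprob n⟩
  let μ₀ : ProbabilityMeasure ℝ := ⟨gaussianReal 0 1, inferInstance⟩
  have hweak : Tendsto μ atTop (𝓝 μ₀) := ProbabilityMeasure.tendsto_iff_tendsto_charFun.2 h
  refine tendsto_iSup_abs_sub_of_monotone (F := fun n a => (P.map (X n)).real (Set.Iic a))
    (fun n a b hab => measureReal_mono (Set.Iic_subset_Iic.2 hab)) (fun n a => measureReal_nonneg)
    (fun n a => measureReal_le_one) (monotone_cdf _) ?_ (tendsto_cdf_atBot _) (tendsto_cdf_atTop _)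
    fun a => ?_
  · rw [continuous_iff_continuousAt]
    intro a
    rw [(monotone_cdf _).continuousAt_iff_leftLim_eq_rightLim, StieltjesFunction.rightLim_eq]
    have h1 := (cdf (gaussianReal 0 1)).measure_singleton a
    -- The jump of the distribution function at `a` is the mass of the atom there, which is zero.
    rw [measure_cdf, measure_singleton, eq_comm, ENNReal.ofReal_eq_zero] at h1
    exact le_antisymm ((monotone_cdf _).leftLim_le le_rfl) (by linarith)
  · rw [cdf_eq_real]
    have := ProbabilityMeasure.tendsto_measure_of_null_frontier_of_tendsto' hweak (E := Set.Iic a)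
      (by rw [frontier_Iic]; exact measure_singleton (μ := gaussianReal 0 1) a)
    exact (ENNReal.tendsto_toReal (measure_ne_top _ _)).comp this

end WeightedCLT

/-! ### Bernoulli variables and size of the weights. -/

section ZeroOne

variable {Ω : Type*} [MeasurableSpace Ω] {P : Measure Ω}

theorem integral_of_zero_or_one {Y : Ω → ℝ} (hm : Measurable Y) (h : ∀ ω, Y ω = 0 ∨ Y ω = 1) :
    ∫ ω, Y ω ∂P = P.real {ω | Y ω = 1} := by
  have hY : Y = Set.indicator {ω | Y ω = 1} 1 := by
    ext ω
    rcases h ω with h | h <;> simp [h]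
  conv_lhs => rw [hY]
  exact integral_indicator_one (hm (measurableSet_singleton 1))

variable [IsProbabilityMeasure P]

theorem memLp_two_of_zero_or_one {Y : Ω → ℝ} (hm : Measurable Y) (h : ∀ ω, Y ω = 0 ∨ Y ω = 1) :
    MemLp Y 2 P := by
  refine MemLp.of_bound hm.aestronglyMeasurable 1 (Eventually.of_forall fun ω => ?_)
  rcases h ω with h | h <;> rw [h] <;> norm_num

theorem variance_of_zero_or_one {Y : Ω → ℝ} (hm : Measurable Y) (h : ∀ ω, Y ω = 0 ∨ Y ω = 1)
    {p : ℝ} (hp : P.real {ω | Y ω = 1} = p) : variance Y P = p * (1 - p) := by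
  have hsq : Y ^ 2 = Y := by
    ext ω
    rcases h ω with h | h <;> simp [h]
  rw [variance_eq_sub (memLp_two_of_zero_or_one hm h), hsq, integral_of_zero_or_one hm h, hp]
  ring

theorem identDistrib_of_zero_or_one {X Y : Ω → ℝ} (hX : Measurable X) (hY : Measurable Y)
    (hX' : ∀ ω, X ω = 0 ∨ X ω = 1) (hY' : ∀ ω, Y ω = 0 ∨ Y ω = 1)
    (h : P.real {ω | X ω = 1} = P.real {ω | Y ω = 1}) : IdentDistrib X Y P P := by
  have key : ∀ {X : Ω → ℝ}, Measurable X → (∀ ω, X ω = 0 ∨ X ω = 1) → ∀ s : Set ℝ,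
      P.real (X ⁻¹' s) = s.indicator 1 0 * (1 - P.real {ω | X ω = 1})
        + s.indicator 1 1 * P.real {ω | X ω = 1} := by
    intro X hX hX' s
    have hmeas : MeasurableSet {ω | X ω = 1} := hX (measurableSet_singleton 1)
    rw [← probReal_compl_eq_one_sub hmeas]
    by_cases h0 : (0 : ℝ) ∈ s <;> by_cases h1 : (1 : ℝ) ∈ s
    · rw [show X ⁻¹' s = Set.univ from Set.eq_univ_of_forall fun ω => by
        rcases hX' ω with h | h <;> simp [h, h0, h1]]
      simp [h0, h1, probReal_compl_eq_one_sub hmeas]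
    · rw [show X ⁻¹' s = {ω | X ω = 1}ᶜ from Set.ext fun ω => by
        rcases hX' ω with h | h <;> simp [h, h0, h1]]
      simp [h0, h1]
    · rw [show X ⁻¹' s = {ω | X ω = 1} from Set.ext fun ω => by
        rcases hX' ω with h | h <;> simp [h, h0, h1]]
      simp [h0, h1]
    · rw [show X ⁻¹' s = ∅ from Set.ext fun ω => by
        rcases hX' ω with h | h <;> simp [h, h0, h1]]
      simp [h0, h1]
  refine ⟨hX.aemeasurable, hY.aemeasurable, Measure.ext fun s hs => ?_⟩
  rw [Measure.map_apply hX hs, Measure.map_apply hY hs, ← measureReal_eq_measureReal_iff,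
    key hX hX', key hY hY', h]

theorem half_pow_five_le {x : ℝ} (hx : 2 ≤ x) : x ^ 5 / 2 ≤ x ^ 5 - x := by
  have h4 : (2 : ℝ) ^ 4 ≤ x ^ 4 := pow_le_pow_left₀ (by norm_num) hx 4
  nlinarith

/-- The normalized weights of the steps of the second kind are uniformly small. -/
theorem eventually_abs_weight_lt {δ : ℝ} (hδ : 0 < δ) : ∀ᶠ N : ℕ in atTop,
    ∀ i ∈ Finset.range N,
      |((i : ℝ) + 1) * (N - 1 - i) / Real.sqrt (((N : ℝ) ^ 5 - N) / 30)| < δ := by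
  -- Weights are at most N² and the squared normalization is at least N⁵/60, so N > 60/δ² suffices.
  obtain ⟨M, hM⟩ := exists_nat_gt (60 / δ ^ 2)
  filter_upwards [eventually_ge_atTop (max M 2)] with N hN i hi
  have hN2 : (2 : ℝ) ≤ N := by exact_mod_cast (le_max_right M 2).trans hN
  have hNM : 60 / δ ^ 2 < N := hM.trans_le (by exact_mod_cast (le_max_left M 2).trans hN)
  have hiN : (i : ℝ) + 1 ≤ N := by exact_mod_cast Finset.mem_range.1 hi
  have hi0 : (0 : ℝ) ≤ i := i.cast_nonneg
  have h1 := half_pow_five_le hN2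
  have hpos : 0 < ((N : ℝ) ^ 5 - N) / 30 := by
    have : (0 : ℝ) < N ^ 5 := by positivity
    linarith
  rw [abs_of_nonneg (div_nonneg (mul_nonneg (by linarith) (by linarith)) (Real.sqrt_nonneg _)),
    div_lt_iff₀ (Real.sqrt_pos.2 hpos)]
  have hle : ((i : ℝ) + 1) * (N - 1 - i) ≤ N ^ 2 := by nlinarith
  refine hle.trans_lt ((sq_lt_sq₀ (by positivity) (by positivity)).1 ?_)
  rw [mul_pow, Real.sq_sqrt hpos.le]
  rw [div_lt_iff₀ (by positivity)] at hNM
  have h2 : (60 : ℝ) * N ^ 4 < N * δ ^ 2 * N ^ 4 := by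
    exact mul_lt_mul_of_pos_right hNM (by positivity)
  nlinarith [sq_nonneg δ]

end ZeroOne

/-! ### Moments and limit law of the random index. -/

section RandomChain

variable {Ω : Type*} [MeasurableSpace Ω] {P : Measure Ω} {p₁ p₂ : ℝ}
  {Z₁ Z₂ : ℕ → Ω → ℝ} {t : ℕ → Ω → Fin 5}

theorem IsRandomChain.zero_or_one (h : IsRandomChain P p₁ p₂ Z₁ Z₂ t) {m : ℕ} (hm : 2 ≤ m) (ω : Ω) :
    Z₂ m ω = 0 ∨ Z₂ m ω = 1 := by
  rcases h.choice m hm ω with h | h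
  · exact Or.inl h.2.1
  · exact Or.inr h.2.1

theorem IsRandomChain.fst_eq (h : IsRandomChain P p₁ p₂ Z₁ Z₂ t) {m : ℕ} (hm : 2 ≤ m) (ω : Ω) :
    Z₁ m ω = 1 - Z₂ m ω := by
  rcases h.choice m hm ω with h | h <;> rw [h.1, h.2.1] <;> norm_num

theorem IsRandomChain.iIndepFun_snd (h : IsRandomChain P p₁ p₂ Z₁ Z₂ t) :
    iIndepFun (fun i : ℕ => Z₂ (i + 2)) P := by
  have hinj : Function.Injective fun i : ℕ => (⟨i + 2, by omega⟩ : {m : ℕ // 2 ≤ m}) := by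
    intro i j hij
    simpa using hij
  exact (h.indep.precomp hinj).comp (fun _ => Prod.snd) fun _ => _root_.measurable_snd

theorem IsRandomChain.exists_kfPlus_eq (h : IsRandomChain P p₁ p₂ Z₁ Z₂ t) (N : ℕ) :
    ∃ A : ℝ, ∀ ω, kfPlus t (N + 1) ω
      = A + ∑ i ∈ Finset.range N, 48 * (((i : ℝ) + 1) * (N - 1 - i)) * Z₂ (i + 2) ω := by
  obtain ⟨A, hA⟩ := exists_additiveDegreeKirchhoff_chainGraph N
  refine ⟨A, fun ω => hA (fun m => t m ω) (fun m => Z₂ m ω) fun m hm => ?_⟩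
  rcases h.choice m hm ω with h | h
  · exact Or.inl h.2
  · exact Or.inr h.2

theorem IsRandomChain.measurable_kfPlus (h : IsRandomChain P p₁ p₂ Z₁ Z₂ t) (N : ℕ) :
    Measurable (kfPlus t (N + 1)) := by
  obtain ⟨A, hA⟩ := h.exists_kfPlus_eq N
  rw [funext hA]
  exact measurable_const.add (Finset.measurable_fun_sum _ fun i _ =>
    (h.measurable_snd (i + 2) (by omega)).const_mul _)

theorem IsRandomChain.integral_snd (h : IsRandomChain P p₁ p₂ Z₁ Z₂ t) {m : ℕ} (hm : 2 ≤ m) :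
    ∫ ω, Z₂ m ω ∂P = p₂ := by
  rw [integral_of_zero_or_one (h.measurable_snd m hm) (h.zero_or_one hm), (h.law_snd m hm).1]

variable [IsProbabilityMeasure P]

theorem IsRandomChain.memLp_snd (h : IsRandomChain P p₁ p₂ Z₁ Z₂ t) {m : ℕ} (hm : 2 ≤ m) :
    MemLp (Z₂ m) 2 P :=
  memLp_two_of_zero_or_one (h.measurable_snd m hm) (h.zero_or_one hm)

theorem IsRandomChain.variance_snd (h : IsRandomChain P p₁ p₂ Z₁ Z₂ t) {m : ℕ} (hm : 2 ≤ m) :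
    variance (Z₂ m) P = p₂ * (1 - p₂) :=
  variance_of_zero_or_one (h.measurable_snd m hm) (h.zero_or_one hm) (h.law_snd m hm).1

/-- As Z₁ = 1 - Z₂, both combinations are a constant plus 48 Z₂, so all three moments equal 48² p₂(1
- p₂). -/
theorem IsRandomChain.step_moments (h : IsRandomChain P p₁ p₂ Z₁ Z₂ t) (hp : p₂ = 1 - p₁)
    {m : ℕ} (hm : 2 ≤ m) :
    variance (fun ω => 216 * Z₁ m ω + 264 * Z₂ m ω) P = sigmaSq p₁ ∧
    variance (fun ω => 133 * Z₁ m ω + 181 * Z₂ m ω) P = sigmaTildeSq p₁ ∧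
    covariance (fun ω => 216 * Z₁ m ω + 264 * Z₂ m ω)
        (fun ω => 133 * Z₁ m ω + 181 * Z₂ m ω) P = rCov p₁ := by
  have hU : (fun ω => 216 * Z₁ m ω + 264 * Z₂ m ω) = fun ω => 216 + 48 * Z₂ m ω := by
    ext ω; rw [h.fst_eq hm]; ring
  have hV : (fun ω => 133 * Z₁ m ω + 181 * Z₂ m ω) = fun ω => 133 + 48 * Z₂ m ω := by
    ext ω; rw [h.fst_eq hm]; ring
  have hL : MemLp (fun ω => 48 * Z₂ m ω) 2 P := (h.memLp_snd hm).const_mul 48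
  have hI : Integrable (fun ω => 48 * Z₂ m ω) P := hL.integrable one_le_two
  rw [hU, hV, variance_const_add hL.1, variance_const_add hL.1, variance_const_mul,
    h.variance_snd hm, covariance_const_add_left hI, covariance_const_add_right hI,
    covariance_const_mul_left, covariance_const_mul_right,
    covariance_self (h.measurable_snd m hm).aemeasurable, h.variance_snd hm, hp]
  refine ⟨?_, ?_, ?_⟩
  · unfold sigmaSq; ring
  · unfold sigmaTildeSq; ring
  · unfold rCov; ring

theorem IsRandomChain.memLp_kfPlus (h : IsRandomChain P p₁ p₂ Z₁ Z₂ t) (N : ℕ) :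
    MemLp (kfPlus t (N + 1)) 2 P := by
  obtain ⟨A, hA⟩ := h.exists_kfPlus_eq N
  rw [funext hA]
  exact (memLp_const A).add (memLp_finsetSum _ fun i _ =>
    (h.memLp_snd (m := i + 2) (by omega)).const_mul _)

theorem IsRandomChain.variance_kfPlus (h : IsRandomChain P p₁ p₂ Z₁ Z₂ t) (N : ℕ) :
    variance (kfPlus t (N + 1)) P = 48 ^ 2 * (p₂ * (1 - p₂)) * (((N : ℝ) ^ 5 - N) / 30) := by
  obtain ⟨A, hA⟩ := h.exists_kfPlus_eq N
  have hL : ∀ i ∈ Finset.range N,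
      MemLp (fun ω => 48 * (((i : ℝ) + 1) * (N - 1 - i)) * Z₂ (i + 2) ω) 2 P :=
    fun i _ => (h.memLp_snd (m := i + 2) (by omega)).const_mul _
  have hind : iIndepFun
      (fun (i : ℕ) ω => 48 * (((i : ℝ) + 1) * (N - 1 - i)) * Z₂ (i + 2) ω) P :=
    h.iIndepFun_snd.comp (fun (i : ℕ) x => 48 * (((i : ℝ) + 1) * (N - 1 - i)) * x)
      fun i => measurable_const_mul _
  have hsum := IndepFun.variance_sum hL fun i _ j _ hij => hind.indepFun hij
  rw [funext hA, variance_const_add (memLp_finsetSum _ hL).1, ← sum_sq_weights, Finset.mul_sum]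
  rw [Finset.sum_fn] at hsum
  rw [hsum]
  refine Finset.sum_congr rfl fun i _ => ?_
  rw [variance_const_mul, h.variance_snd (by omega)]
  ring

/-- The normalized index as a weighted sum of the normalized steps. -/
theorem IsRandomChain.normalized_kfPlus (h : IsRandomChain P p₁ p₂ Z₁ Z₂ t)
    (hp₂ : 0 < p₂ ∧ p₂ < 1) (N : ℕ) (ω : Ω) :
    (kfPlus t (N + 1) ω - ∫ ω', kfPlus t (N + 1) ω' ∂P)
        / Real.sqrt (variance (kfPlus t (N + 1)) P)
      = ∑ i ∈ Finset.range N, ((i : ℝ) + 1) * (N - 1 - i) / Real.sqrt (((N : ℝ) ^ 5 - N) / 30)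
        * ((Z₂ (i + 2) ω - p₂) / Real.sqrt (p₂ * (1 - p₂))) := by
  have hv : 0 ≤ p₂ * (1 - p₂) := mul_nonneg hp₂.1.le (by linarith [hp₂.2])
  obtain ⟨A, hA⟩ := h.exists_kfPlus_eq N
  have hE : ∫ ω', kfPlus t (N + 1) ω' ∂P
      = A + ∑ i ∈ Finset.range N, 48 * (((i : ℝ) + 1) * (N - 1 - i)) * p₂ := by
    have hL : ∀ i ∈ Finset.range N,
        Integrable (fun ω => 48 * (((i : ℝ) + 1) * (N - 1 - i)) * Z₂ (i + 2) ω) P :=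
      fun i _ => ((h.memLp_snd (m := i + 2) (by omega)).integrable one_le_two).const_mul _
    rw [integral_congr_ae (Eventually.of_forall hA), integral_add (integrable_const A)
      (integrable_finsetSum _ hL), integral_finsetSum _ hL]
    congr 1
    · simp
    · refine Finset.sum_congr rfl fun i _ => ?_
      rw [integral_const_mul, h.integral_snd (by omega)]
  -- For N ≤ 1 the variance is 0, and division by zero makes both sides 0; no lower bound on `N` is
  -- needed.
  rw [h.variance_kfPlus, Real.sqrt_mul (by positivity), Real.sqrt_mul (by positivity),
    Real.sqrt_sq (by norm_num), hE, hA, add_sub_add_left_eq_sub, ← Finset.sum_sub_distrib,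
    Finset.sum_div]
  refine Finset.sum_congr rfl fun i _ => ?_
  rw [← mul_sub, mul_assoc 48, mul_assoc 48, mul_div_mul_left _ _ (by norm_num : (48 : ℝ) ≠ 0),
    div_mul_div_comm, mul_comm (Real.sqrt (p₂ * (1 - p₂)))]

theorem IsRandomChain.tendsto_cdf (h : IsRandomChain P p₁ p₂ Z₁ Z₂ t) (hp₂ : 0 < p₂ ∧ p₂ < 1) :
    Tendsto (fun n : ℕ => ⨆ a : ℝ,
        |P.real {ω | (kfPlus t n ω - ∫ ω', kfPlus t n ω' ∂P)
              / Real.sqrt (variance (kfPlus t n) P) ≤ a}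
          - ∫ x in Set.Iic a, (1 / Real.sqrt (2 * Real.pi)) * Real.exp (-(x ^ 2) / 2)|)
      atTop (𝓝 0) := by
  have hv : 0 < p₂ * (1 - p₂) := mul_pos hp₂.1 (by linarith [hp₂.2])
  rw [← tendsto_add_atTop_iff_nat 1]
  refine tendsto_iSup_of_tendsto_charFun (X := fun N ω =>
    (kfPlus t (N + 1) ω - ∫ ω', kfPlus t (N + 1) ω' ∂P)
      / Real.sqrt (variance (kfPlus t (N + 1)) P))
    (fun N => ((h.measurable_kfPlus N).sub_const _).div_const _) fun s => ?_
  simp only [h.normalized_kfPlus hp₂]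
  refine tendsto_charFun_weighted_sum
    (ξ := fun i ω => (Z₂ (i + 2) ω - p₂) / Real.sqrt (p₂ * (1 - p₂)))
    (h.iIndepFun_snd.comp (fun _ x => (x - p₂) / Real.sqrt (p₂ * (1 - p₂)))
      fun _ => (measurable_id.sub_const _).div_const _) (fun i => ?_) ?_ ?_
    (fun N i => ((i : ℝ) + 1) * (N - 1 - i) / Real.sqrt (((N : ℝ) ^ 5 - N) / 30)) ?_
    (fun δ hδ => eventually_abs_weight_lt hδ) s
  · exact (identDistrib_of_zero_or_one (h.measurable_snd (i + 2) (by omega))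
      (h.measurable_snd (0 + 2) (by omega)) (h.zero_or_one (by omega)) (h.zero_or_one (by omega))
      (by rw [(h.law_snd (i + 2) (by omega)).1, (h.law_snd (0 + 2) (by omega)).1])).comp
      (u := fun x => (x - p₂) / Real.sqrt (p₂ * (1 - p₂)))
      ((measurable_id.sub_const _).div_const _)
  · rw [integral_div, integral_sub ((h.memLp_snd (by omega)).integrable one_le_two)
      (integrable_const p₂), h.integral_snd (by omega)]
    simp
  · have hvar := h.variance_snd (m := 0 + 2) (by omega)
    rw [variance_eq_integral (h.measurable_snd _ (by omega)).aemeasurable,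
      h.integral_snd (by omega)] at hvar
    simp only [div_pow, Real.sq_sqrt hv.le]
    rw [integral_div, hvar, div_self hv.ne']
  · filter_upwards [eventually_ge_atTop 2] with N hN
    have hN2 : (2 : ℝ) ≤ N := by exact_mod_cast hN
    have hpos : 0 < ((N : ℝ) ^ 5 - N) / 30 := by
      have h1 := half_pow_five_le hN2
      have : (0 : ℝ) < N ^ 5 := by positivity
      linarith
    simp only [div_pow, Real.sq_sqrt hpos.le]
    rw [← Finset.sum_div, sum_sq_weights, div_self hpos.ne']

end RandomChain

end PentagonChain

theorem theorem3p4 {Ω : Type*} [MeasurableSpace Ω] (P : Measure Ω) [IsProbabilityMeasure P]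
    (p₁ p₂ : ℝ) (hp : p₂ = 1 - p₁) (hp₁ : 0 < p₁ ∧ p₁ < 1) (hp₂ : 0 < p₂ ∧ p₂ < 1)
    (Z₁ Z₂ : ℕ → Ω → ℝ) (t : ℕ → Ω → Fin 5)
    (h : PentagonChain.IsRandomChain P p₁ p₂ Z₁ Z₂ t) :
    -- the three constants are the variances and the covariance of `Ũ_m`, `Ṽ_m`
    (∀ m : ℕ, 2 ≤ m →
      variance (fun ω => 216 * Z₁ m ω + 264 * Z₂ m ω) P = PentagonChain.sigmaSq p₁ ∧
      variance (fun ω => 133 * Z₁ m ω + 181 * Z₂ m ω) P = PentagonChain.sigmaTildeSq p₁ ∧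
      covariance (fun ω => 216 * Z₁ m ω + 264 * Z₂ m ω)
        (fun ω => 133 * Z₁ m ω + 181 * Z₂ m ω) P = PentagonChain.rCov p₁) ∧
    -- the index is a square integrable random variable, with the stated variance
    (∀ n : ℕ, 1 ≤ n →
      MemLp (PentagonChain.kfPlus t n) 2 P ∧
      variance (PentagonChain.kfPlus t n) P =
        (1 / 30) * (PentagonChain.sigmaSq p₁ * (n : ℝ) ^ 5
          - 5 * PentagonChain.rCov p₁ * (n : ℝ) ^ 4
          + 10 * PentagonChain.sigmaTildeSq p₁ * (n : ℝ) ^ 3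
          + (65 * PentagonChain.rCov p₁ - 30 * PentagonChain.sigmaSq p₁
              - 45 * PentagonChain.sigmaTildeSq p₁) * (n : ℝ) ^ 2
          + (59 * PentagonChain.sigmaSq p₁ + 65 * PentagonChain.sigmaTildeSq p₁
              - 120 * PentagonChain.rCov p₁) * (n : ℝ)
          + (60 * PentagonChain.rCov p₁ - 30 * PentagonChain.sigmaSq p₁
              - 30 * PentagonChain.sigmaTildeSq p₁))) ∧
    -- asymptotic normality, uniformly in `a`
    Tendsto (fun n : ℕ => ⨆ a : ℝ,
        |P.real {ω | (PentagonChain.kfPlus t n ω - ∫ ω', PentagonChain.kfPlus t n ω' ∂P)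
              / Real.sqrt (variance (PentagonChain.kfPlus t n) P) ≤ a}
          - ∫ x in Set.Iic a, (1 / Real.sqrt (2 * Real.pi)) * Real.exp (-(x ^ 2) / 2)|)
      atTop (𝓝 0) := by

  refine ⟨fun m hm => h.step_moments hp hm, fun n hn => ?_, h.tendsto_cdf hp₂⟩
  obtain ⟨N, rfl⟩ := Nat.exists_eq_add_of_le' hn
  refine ⟨h.memLp_kfPlus N, ?_⟩
  rw [h.variance_kfPlus, hp]
  -- All three constants equal 48² p₁(1 - p₁), and the polynomial collapses to (n - 1)⁵ - (n - 1).
  unfold PentagonChain.sigmaSq PentagonChain.sigmaTildeSq PentagonChain.rCov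
  push_cast
  ring
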